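/- Let $\mathcal{O}$ be a norm-finite Dedekind domain, i.e. a Dedekind domain such that $\mathcal{O}/a\mathcal{O}$ is finite for every nonzero $a \in \mathcal{O}$, and let $K$ be its field of fractions. For a nonzero ideal $\mathfrak{a}$ of $\mathcal{O}$ write $\mathrm{N}(\mathfrak{a}) = |\mathcal{O}/\mathfrak{a}|$. Let $U = \mathrm{GL}_2(\mathcal{O})$ be the set of $2 \times 2$ matrices over $\mathcal{O}$ whose determinant is a unit, and let $A = \begin{pmatrix} a & b \\ c & d \end{pmatrix}$ be a $2 \times 2$ matrix over $\mathcal{O}$ with $\det A \neq 0$. Put $\mathfrak{d}_1(A) = a\mathcal{O} + b\mathcal{O} + c\mathcal{O} + d\mathcal{O}$, $\mathfrak{d}_2(A) = (\det A)\mathcal{O}$, and let $\mathfrak{f}_2(A) = \mathfrak{d}_2(A)\,\mathfrak{d}_1(A)^{-2}$, a fractional ideal of $K$. Then $\mathfrak{f}_2(A)$ is a nonzero (integral) ideal of $\mathcal{O}$, and the set $U \backslash UAU = \{UB : B \in UAU\}$ of right cosets contained in the double coset $UAU$ is finite, of cardinality \[ \mu(A) = |U \backslash UAU| = \mathrm{N}(\mathfrak{f}_2(A))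 \prod_{\substack{\mathfrak{p} \text{ prime ideal of } \mathcal{O} \\ \mathfrak{p} \mid \mathfrak{f}_2(A)}} \bigl(1 + \mathrm{N}(\mathfrak{p})^{-1}\bigr). \] -/

import Mathlib

open scoped nonZeroDivisors Pointwise

namespace CosetCount

section Matrices

variable {O : Type*} [CommRing O]

/-- `U = GL₂(O)`, as the set of `2 × 2` matrices over `O` whose determinant is a unit. -/
def unimodular (O : Type*) [CommRing O] : Set (Matrix (Fin 2) (Fin 2) O) :=
  {P | IsUnit P.det}

/-- The right coset `U B = {P * B | P ∈ U}`. -/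
def rightCoset (B : Matrix (Fin 2) (Fin 2) O) : Set (Matrix (Fin 2) (Fin 2) O) :=
  unimodular O * {B}

/-- `U \ U A U`: the set of right cosets `U B` with `B` in the double coset
`U A U = {P * A * Q | P, Q ∈ U}`. -/
def rightCosetsIn (A : Matrix (Fin 2) (Fin 2) O) : Set (Set (Matrix (Fin 2) (Fin 2) O)) :=
  rightCoset '' DoubleCoset.doubleCoset A (unimodular O) (unimodular O)

/-- The first determinantal divisor: the ideal generated by the entries of `A`. -/
def detDivisor₁ (A : Matrix (Fin 2) (Fin 2) O) : Ideal O :=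
  Ideal.span {A 0 0, A 0 1, A 1 0, A 1 1}

/-- The second determinantal divisor: the ideal generated by `det A`. -/
def detDivisor₂ (A : Matrix (Fin 2) (Fin 2) O) : Ideal O :=
  Ideal.span {A.det}

end Matrices

section Ideals

variable {O : Type*} [CommRing O] [IsDedekindDomain O]

/-- The second fundamental factor `d₂(A) d₁(A)⁻²`, a fractional ideal of the field of
fractions `K` of `O`. -/
noncomputable def fundamentalFactor₂ (K : Type*) [Field K] [Algebra O K] [IsFractionRing O K]
    (A : Matrix (Fin 2) (Fin 2) O) : FractionalIdeal O⁰ K :=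
  (detDivisor₂ A : FractionalIdeal O⁰ K) * (detDivisor₁ A : FractionalIdeal O⁰ K) ^ (-2 : ℤ)

/-- The norm of an ideal: the number of its residue classes. (`Ideal.absNorm` is only available
for rings that are free as abelian groups.) -/
noncomputable def idealNorm (I : Ideal O) : ℕ := Nat.card (O ⧸ I)

/-- The set of prime ideals dividing `I`. -/
def primeDivisors (I : Ideal O) : Set (Ideal O) := {p | p.IsPrime ∧ p ∣ I}

/-- A nonzero ideal has only finitely many prime divisors, so products over them are finite. -/
theorem primeDivisors_finite {I : Ideal O} (hI : I ≠ ⊥) : (primeDivisors I).Finite := by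
  have : Fintype {p : Ideal O // p ∣ I} := UniqueFactorizationMonoid.fintypeSubtypeDvd I hI
  have h : {p : Ideal O | p ∣ I}.Finite :=
    Set.finite_coe_iff.mp (inferInstance : Finite {p : Ideal O // p ∣ I})
  exact h.subset fun p hp => hp.2

end Ideals

end CosetCount

/-! Write `𝔣` for the integral ideal with `detDivisor₂ A = 𝔣 * detDivisor₁ A ^ 2`. The cosets
correspond to the points of the projective line over `O ⧸ 𝔣`.

To `B = A * Q` attach the module `columnsInto (𝔣 * detDivisor₁ A) B` of vectors `v` with all entries
of `B *ᵥ v` in `𝔣 * detDivisor₁ A`. It is unchanged when `B` is multiplied on the left by `U`, it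
contains all vectors with entries in `𝔣`, and modulo `𝔣` it is a line spanned by a unimodular vector
(`exists_columnsInto_eq_line`). Conversely it determines the coset
(`exists_mul_eq_of_columnsInto_le`). Replacing `A` by `A * Q` pulls the line back along `Q`.
Unimodular pairs modulo `𝔣` lift to `O` (`exists_isCoprime_lift`), so `U` reaches every line
(`image_comap_mulVecLin_eq_lines`).

The number of lines is the number of unimodular pairs divided by the number of units. Both are
counted in the product of the residue fields (`ncard_lines_of_surjective`). -/

namespace CosetCount

open Matrix

/-! ### Lines over a finite ring. -/

section Counting

/-- A surjective homomorphism of groups has fibres of constant size. -/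
theorem natCard_preimage_of_surjective {G H : Type*} [AddGroup G] [AddGroup H] (φ : G →+ H)
    (hφ : Function.Surjective φ) (P : H → Prop) :
    Nat.card {g : G // P (φ g)} = Nat.card φ.ker * Nat.card {h : H // P h} := by
  obtain ⟨s, hs⟩ := hφ.hasRightInverse
  rw [← Nat.card_prod]
  refine Nat.card_congr
    { toFun := fun g => (⟨g.1 - s (φ g.1), ?_⟩, ⟨φ g.1, g.2⟩)
      invFun := fun x => ⟨x.1.1 + s x.2.1, ?_⟩
      left_inv := ?_
      right_inv := ?_ }
  · rw [AddMonoidHom.mem_ker, map_sub, hs, sub_self]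
  · rw [map_add, x.1.2, zero_add, hs]
    exact x.2.2
  · intro g
    simp
  · rintro ⟨⟨x, hx⟩, ⟨y, hy⟩⟩
    rw [AddMonoidHom.mem_ker] at hx
    ext <;> simp [hx, hs y]

theorem natCard_forall_ne_zero {ι : Type*} [Fintype ι] {k : ι → Type*} [∀ i, Zero (k i)]
    [∀ i, Finite (k i)] :
    Nat.card {h : ∀ i, k i // ∀ i, h i ≠ 0} = ∏ i, (Nat.card (k i) - 1) := by
  rw [Nat.card_congr (Equiv.subtypePiEquivPi (p := fun {i} (x : k i) => x ≠ 0)), Nat.card_pi]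
  refine Finset.prod_congr rfl fun i _ => ?_
  have := Fintype.ofFinite (k i)
  classical
  simp [Nat.card_eq_fintype_card, Fintype.card_subtype_compl]

variable {R : Type*} [CommRing R]

/-- The set of lines in `R²`: the submodules spanned by one unimodular vector. -/
def lines (R : Type*) [CommRing R] : Set (Submodule R (Fin 2 → R)) :=
  (fun w => Submodule.span R {w}) '' {w | IsCoprime (w 0) (w 1)}

/-- The unit group acts simply transitively on the unimodular generators of a line: a Bézout
relation for the generator allows scalars to be cancelled. -/
theorem natCard_coprime_eq_ncard_lines_mul :
    Nat.card {w : Fin 2 → R // IsCoprime (w 0) (w 1)} = (lines R).ncard * Nat.card Rˣ := by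
  have hrep : ∀ l : lines R, ∃ w : Fin 2 → R, IsCoprime (w 0) (w 1) ∧ Submodule.span R {w} = l.1 :=
    fun l => l.2
  choose r hr hl using hrep
  rw [← Nat.card_coe_set_eq, ← Nat.card_prod]
  symm
  refine Nat.card_eq_of_bijective
    (fun x => ⟨(x.2 : R) • r x.1, ?_⟩) ⟨?_, ?_⟩
  · obtain ⟨a, b, hab⟩ := hr x.1
    refine ⟨a * ((x.2⁻¹ : Rˣ) : R), b * ((x.2⁻¹ : Rˣ) : R), ?_⟩
    simp only [Pi.smul_apply, smul_eq_mul]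
    linear_combination hab + (a * r x.1 0 + b * r x.1 1) * x.2.inv_mul
  · rintro ⟨l, u⟩ ⟨m, v⟩ h
    have h : (u : R) • r l = (v : R) • r m := congrArg Subtype.val h
    have hlm : l = m := by
      apply Subtype.ext
      rw [← hl l, ← hl m, ← Submodule.span_singleton_smul_eq u.isUnit, h,
        Submodule.span_singleton_smul_eq v.isUnit]
    subst hlm
    obtain ⟨a, b, hab⟩ := hr l
    have h0 := congrFun h 0
    have h1 := congrFun h 1
    simp only [Pi.smul_apply, smul_eq_mul] at h0 h1
    have : (u : R) = v := by
      linear_combination a * h0 + b * h1 - ((u : R) - v) * hab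
    rw [Units.ext this]
  · rintro ⟨w, hw⟩
    let l : lines R := ⟨Submodule.span R {w}, w, hw, rfl⟩
    have h1 : w ∈ Submodule.span R {r l} := hl l ▸ Submodule.mem_span_singleton_self w
    have h2 : r l ∈ Submodule.span R {w} := by
      have : r l ∈ l.1 := hl l ▸ Submodule.mem_span_singleton_self (r l)
      exact this
    obtain ⟨c, hc⟩ := Submodule.mem_span_singleton.1 h1
    obtain ⟨d, hd⟩ := Submodule.mem_span_singleton.1 h2
    obtain ⟨a, b, hab⟩ := hw
    have hcd : c * d = 1 := by
      have e : (c * d) • w = w := by rw [mul_smul, hd, hc]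
      have e0 := congrFun e 0
      have e1 := congrFun e 1
      simp only [Pi.smul_apply, smul_eq_mul] at e0 e1
      linear_combination a * e0 + b * e1 - (c * d - 1) * hab
    exact ⟨(l, ⟨c, d, hcd, by rw [mul_comm, hcd]⟩), Subtype.ext hc⟩

variable {ι : Type*} {k : ι → Type*} [∀ i, Field (k i)]

/-- By `hmax` every maximal ideal is the kernel of a coordinate of `φ`, and a pair that is not
coprime lies in some maximal ideal. -/
theorem isCoprime_iff_forall_ne_zero (φ : R →+* ∀ i, k i)
    (hmax : ∀ M : Ideal R, M.IsMaximal → ∃ i, ∀ x, φ x i = 0 ↔ x ∈ M) (x y : R) :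
    IsCoprime x y ↔ ∀ i, (φ x i, φ y i) ≠ 0 := by
  constructor
  · rintro ⟨a, b, h⟩ i hxy
    obtain ⟨hx, hy⟩ := Prod.mk_eq_zero.1 hxy
    have := congrFun (congrArg φ h) i
    simp [hx, hy] at this
  · intro h
    rw [← Ideal.isCoprime_span_singleton_iff, Ideal.isCoprime_iff_sup_eq]
    by_contra hne
    obtain ⟨M, hM, hle⟩ := Ideal.exists_le_maximal _ hne
    obtain ⟨i, hi⟩ := hmax M hM
    refine h i (Prod.mk_eq_zero.2 ⟨(hi x).2 (hle ?_), (hi y).2 (hle ?_)⟩)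
    · exact Ideal.mem_sup_left (Ideal.mem_span_singleton_self x)
    · exact Ideal.mem_sup_right (Ideal.mem_span_singleton_self y)

/-- The number of lines in `R²` for a finite ring `R`, given by its residue fields. -/
theorem ncard_lines_of_surjective [Fintype ι] [Finite R] (φ : R →+* ∀ i, k i) (hφ : Function.Surjective φ)
    (hmax : ∀ M : Ideal R, M.IsMaximal → ∃ i, ∀ x, φ x i = 0 ↔ x ∈ M) :
    ((lines R).ncard : ℚ) = Nat.card R * ∏ i, (1 + (Nat.card (k i) : ℚ)⁻¹) := by
  have hev : ∀ i, Function.Surjective fun x => φ x i := fun i y => by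
    classical
    obtain ⟨x, hx⟩ := hφ (Pi.single i y)
    exact ⟨x, by simp [hx]⟩
  have hfin : ∀ i, Finite (k i) := fun i => Finite.of_surjective _ (hev i)
  let f : R →+ ∀ i, k i := φ.toAddMonoidHom
  let g : (Fin 2 → R) →+ ∀ i, k i × k i :=
    { toFun := fun w i => (φ (w 0) i, φ (w 1) i)
      map_zero' := by ext <;> simp
      map_add' := fun v w => by ext <;> simp }
  have hg : Function.Surjective g := fun h => by
    obtain ⟨x, hx⟩ := hφ fun i => (h i).1
    obtain ⟨y, hy⟩ := hφ fun i => (h i).2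
    refine ⟨![x, y], funext fun i => Prod.ext ?_ ?_⟩
    · exact congrFun hx i
    · exact congrFun hy i
  have hker : Nat.card g.ker = Nat.card f.ker * Nat.card f.ker := by
    rw [← Nat.card_prod]
    refine Nat.card_congr
      { toFun := fun w => (⟨w.1 0, ?_⟩, ⟨w.1 1, ?_⟩)
        invFun := fun x => ⟨![x.1.1, x.2.1], ?_⟩
        left_inv := ?_
        right_inv := ?_ }
    · exact funext fun i => congrArg Prod.fst (congrFun w.2 i)
    · exact funext fun i => congrArg Prod.snd (congrFun w.2 i)
    · exact funext fun i => Prod.ext (congrFun x.1.2 i) (congrFun x.2.2 i)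
    · rintro ⟨w, hw⟩
      ext i
      fin_cases i <;> rfl
    · rintro ⟨x, y⟩
      rfl
  have hR : Nat.card R = Nat.card f.ker * ∏ i, Nat.card (k i) := by
    have := natCard_preimage_of_surjective f hφ fun _ => True
    rwa [Nat.card_congr (Equiv.subtypeUnivEquiv fun _ => trivial),
      Nat.card_congr (Equiv.subtypeUnivEquiv fun _ => trivial), Nat.card_pi] at this
  have hU : Nat.card Rˣ = Nat.card f.ker * ∏ i, (Nat.card (k i) - 1) := by
    have hunits : Nat.card Rˣ = Nat.card {x : R // IsUnit x} :=
      Nat.card_eq_of_bijective (fun u => ⟨u, u.isUnit⟩)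
        ⟨fun u v h => Units.ext (congrArg Subtype.val h), fun x => ⟨x.2.unit, rfl⟩⟩
    rw [← natCard_forall_ne_zero, ← natCard_preimage_of_surjective f hφ fun h => ∀ i, h i ≠ 0,
      hunits]
    refine Nat.card_congr (Equiv.subtypeEquivRight fun x => ?_)
    -- A unit is an element coprime to itself, so the criterion for pairs also counts units.
    rw [← isCoprime_self, isCoprime_iff_forall_ne_zero φ hmax]
    refine forall_congr' fun i => not_congr ?_
    rw [Prod.mk_eq_zero, and_self]
    rfl
  have hX : Nat.card {w : Fin 2 → R // IsCoprime (w 0) (w 1)} =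
      Nat.card f.ker * Nat.card f.ker * ∏ i, (Nat.card (k i) * Nat.card (k i) - 1) := by
    have e : ∏ i, (Nat.card (k i) * Nat.card (k i) - 1) = ∏ i, (Nat.card (k i × k i) - 1) := by
      simp only [Nat.card_prod]
    rw [e, ← natCard_forall_ne_zero, ← hker,
      ← natCard_preimage_of_surjective g hg fun h => ∀ i, h i ≠ 0]
    exact Nat.card_congr (Equiv.subtypeEquivRight fun w =>
      isCoprime_iff_forall_ne_zero φ hmax (w 0) (w 1))
  have hmain := natCard_coprime_eq_ncard_lines_mul (R := R)
  rw [hX, hU] at hmain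
  have hc : (Nat.card f.ker : ℚ) ≠ 0 := Nat.cast_ne_zero.2 Nat.card_pos.ne'
  have hq : ∀ i, 1 < Nat.card (k i) := fun i => Finite.one_lt_card
  -- The local factor: `q² - 1 = q (1 + q⁻¹) (q - 1)`, where `q - 1` cancels against the units.
  have h2 : ∀ i, ((Nat.card (k i) * Nat.card (k i) - 1 : ℕ) : ℚ) =
      (Nat.card (k i) : ℚ) * (1 + (Nat.card (k i) : ℚ)⁻¹) * ((Nat.card (k i) - 1 : ℕ) : ℚ) := by
    intro i
    have h0 : (Nat.card (k i) : ℚ) ≠ 0 := Nat.cast_ne_zero.2 (by have := hq i; omega)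
    rw [Nat.cast_sub (by nlinarith [hq i]), Nat.cast_sub (hq i).le]
    push_cast
    field_simp
    ring
  have hp : (∏ i, ((Nat.card (k i) - 1 : ℕ) : ℚ)) ≠ 0 :=
    Finset.prod_ne_zero_iff.2 fun i _ => Nat.cast_ne_zero.2 (by have := hq i; omega)
  have hmain' := congrArg (Nat.cast : ℕ → ℚ) hmain
  rw [Nat.cast_mul, Nat.cast_mul, Nat.cast_mul, Nat.cast_mul, Nat.cast_prod, Nat.cast_prod,
    Finset.prod_congr rfl fun i _ => h2 i, Finset.prod_mul_distrib,
    Finset.prod_mul_distrib] at hmain'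
  rw [hR, Nat.cast_mul, Nat.cast_prod]
  refine mul_right_cancel₀ (mul_ne_zero hc hp) ?_
  rw [← hmain']
  ring

end Counting

/-! ### Residue fields of `O ⧸ I` and lifting of unimodular pairs. -/

section Dedekind

variable {O : Type*} [CommRing O] [IsDedekindDomain O]

theorem isMaximal_of_mem_primeDivisors {I : Ideal O} (hI : I ≠ ⊥) {p : Ideal O}
    (hp : p ∈ primeDivisors I) : p.IsMaximal :=
  hp.1.isMaximal fun h => hI (le_bot_iff.1 (h ▸ Ideal.dvd_iff_le.1 hp.2))

/-- The projection of `O / I` to the residue fields of the prime divisors of `I`. -/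
def toResidue (I : Ideal O) : O ⧸ I →+* ∀ p : primeDivisors I, O ⧸ p.1 :=
  RingHom.pi fun p => Ideal.Quotient.factor (Ideal.dvd_iff_le.1 p.2.2)

theorem toResidue_mk (I : Ideal O) (x : O) (p : primeDivisors I) :
    toResidue I (Ideal.Quotient.mk I x) p = Ideal.Quotient.mk p.1 x := rfl

theorem pairwise_isCoprime_primeDivisors {I : Ideal O} (hI : I ≠ ⊥) :
    Pairwise (Function.onFun IsCoprime fun p : primeDivisors I => p.1) := fun p q hpq => by
  have := isMaximal_of_mem_primeDivisors hI p.2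
  have := isMaximal_of_mem_primeDivisors hI q.2
  exact Ideal.isCoprime_of_isMaximal fun h => hpq (Subtype.ext h)

theorem toResidue_surjective {I : Ideal O} (hI : I ≠ ⊥) :
    Function.Surjective (toResidue I) := fun h => by
  have : Finite (primeDivisors I) := primeDivisors_finite hI
  obtain ⟨r, hr⟩ := Ideal.pi_quotient_surjective (pairwise_isCoprime_primeDivisors hI) h
  exact ⟨Ideal.Quotient.mk I r, funext hr⟩

theorem exists_toResidue_eq_zero_iff {I : Ideal O} (M : Ideal (O ⧸ I)) (hM : M.IsMaximal) :
    ∃ p, ∀ x, toResidue I x p = 0 ↔ x ∈ M := by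
  refine ⟨⟨M.comap (Ideal.Quotient.mk I), inferInstance, Ideal.dvd_iff_le.2 fun x hx => ?_⟩,
    fun x => ?_⟩
  · rw [Ideal.mem_comap, Ideal.Quotient.eq_zero_iff_mem.2 hx]
    exact M.zero_mem
  · obtain ⟨x, rfl⟩ := Ideal.Quotient.mk_surjective x
    rw [toResidue_mk, Ideal.Quotient.eq_zero_iff_mem, Ideal.mem_comap]

theorem isCoprime_mk_iff {I : Ideal O} (hI : I ≠ ⊥) (x y : O) :
    IsCoprime (Ideal.Quotient.mk I x) (Ideal.Quotient.mk I y) ↔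
      ∀ p ∈ primeDivisors I, ¬ (x ∈ p ∧ y ∈ p) := by
  let _ : ∀ p : primeDivisors I, Field (O ⧸ p.1) := fun p =>
    have := isMaximal_of_mem_primeDivisors hI p.2
    Ideal.Quotient.field p.1
  rw [isCoprime_iff_forall_ne_zero (toResidue I) exists_toResidue_eq_zero_iff, Subtype.forall]
  refine forall₂_congr fun p hp => not_congr ?_
  rw [Prod.mk_eq_zero, toResidue_mk, toResidue_mk]
  exact and_congr Ideal.Quotient.eq_zero_iff_mem Ideal.Quotient.eq_zero_iff_mem

theorem ncard_lines_quotient {I : Ideal O} (hI : I ≠ ⊥) [Finite (O ⧸ I)] :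
    ((lines (O ⧸ I)).ncard : ℚ) =
      (idealNorm I : ℚ) * ∏ᶠ p ∈ primeDivisors I, (1 + (idealNorm p : ℚ)⁻¹) := by
  let _ : ∀ p : primeDivisors I, Field (O ⧸ p.1) := fun p =>
    have := isMaximal_of_mem_primeDivisors hI p.2
    Ideal.Quotient.field p.1
  let _ : Fintype (primeDivisors I) := (primeDivisors_finite hI).fintype
  rw [ncard_lines_of_surjective (toResidue I) (toResidue_surjective hI)
    exists_toResidue_eq_zero_iff, ← finprod_set_coe_eq_finprod_mem, finprod_eq_prod_of_fintype]
  rfl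

/-- A pair that is unimodular modulo a nonzero ideal lifts to a unimodular pair. -/
theorem exists_isCoprime_lift {I : Ideal O} (hI : I ≠ ⊥) (u v : O ⧸ I) (huv : IsCoprime u v) :
    ∃ x y : O, IsCoprime x y ∧ Ideal.Quotient.mk I x = u ∧ Ideal.Quotient.mk I y = v := by
  obtain ⟨x, rfl⟩ := Ideal.Quotient.mk_surjective u
  -- A nonzero lift `y` has only finitely many prime divisors, so the Chinese remainder theorem
  -- applies to them.
  obtain ⟨y, hy0, rfl⟩ : ∃ y : O, y ≠ 0 ∧ Ideal.Quotient.mk I y = v := by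
    obtain ⟨y, rfl⟩ := Ideal.Quotient.mk_surjective v
    by_cases hy : y = 0
    · obtain ⟨z, hz, hz0⟩ := Submodule.exists_mem_ne_zero_of_ne_bot hI
      exact ⟨z, hz0, by rw [hy, map_zero, Ideal.Quotient.eq_zero_iff_mem.2 hz]⟩
    · exact ⟨y, hy, rfl⟩
  rw [isCoprime_mk_iff hI] at huv
  have hy : Ideal.span {y} ≠ ⊥ := by rwa [Ne, Ideal.span_singleton_eq_bot]
  let ι := {p : primeDivisors (Ideal.span {y}) // ¬ I ≤ p.1}
  have : Finite (primeDivisors (Ideal.span {y})) := primeDivisors_finite hy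
  have hcop : ∀ p : ι, IsCoprime I p.1.1 := fun p => by
    have := isMaximal_of_mem_primeDivisors hy p.1.2
    rw [isCoprime_comm, Ideal.isCoprime_iff_sup_eq]
    exact this.1.2 _ (lt_of_le_of_ne le_sup_left fun h => p.2 (h ▸ le_sup_right))
  have hpw : Pairwise (Function.onFun IsCoprime
      fun i : Option ι => i.elim I fun p => p.1.1) := by
    rintro (_ | p) (_ | q) h
    · exact absurd rfl h
    · exact hcop q
    · exact (hcop p).symm
    · exact pairwise_isCoprime_primeDivisors hy fun e => h (congrArg some (Subtype.ext e))
  -- `x + t` agrees with `x` modulo `I` and is `1` modulo each prime dividing `y` but not `I`. At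
  -- the primes dividing `I`, `huv` suffices.
  obtain ⟨t, ht⟩ := Ideal.exists_forall_sub_mem_ideal hpw fun i => i.elim 0 fun _ => 1 - x
  have htI : t ∈ I := by simpa using ht none
  refine ⟨x + t, y, ?_, ?_, rfl⟩
  · rw [← Ideal.isCoprime_span_singleton_iff, Ideal.isCoprime_iff_sup_eq]
    by_contra hne
    obtain ⟨M, hM, hle⟩ := Ideal.exists_le_maximal _ hne
    have hx : x + t ∈ M := hle (Ideal.mem_sup_left (Ideal.mem_span_singleton_self _))
    have hyM : y ∈ M := hle (Ideal.mem_sup_right (Ideal.mem_span_singleton_self _))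
    by_cases hIM : I ≤ M
    · exact huv M ⟨hM.isPrime, Ideal.dvd_iff_le.2 hIM⟩
        ⟨by simpa using M.sub_mem hx (hIM htI), hyM⟩
    · have h1 : t - (1 - x) ∈ M := ht (some ⟨⟨M, hM.isPrime, Ideal.dvd_iff_le.2
        ((Ideal.span_singleton_le_iff_mem M).2 hyM)⟩, hIM⟩)
      exact hM.ne_top ((Ideal.eq_top_iff_one M).2 (by convert M.sub_mem hx h1 using 1; ring))
  · rw [map_add, Ideal.Quotient.eq_zero_iff_mem.2 htI, add_zero]

end Dedekind

/-! ### Right cosets and the modules `columnsInto`. -/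

section Cosets

variable {O : Type*} [CommRing O]

theorem mem_rightCoset {B C : Matrix (Fin 2) (Fin 2) O} :
    C ∈ rightCoset B ↔ ∃ P, IsUnit P.det ∧ P * B = C := by
  simp [rightCoset, unimodular]

theorem rightCoset_mul_left {P : Matrix (Fin 2) (Fin 2) O} (hP : IsUnit P.det)
    (B : Matrix (Fin 2) (Fin 2) O) : rightCoset (P * B) = rightCoset B := by
  ext C
  simp only [mem_rightCoset]
  constructor
  · rintro ⟨M, hM, rfl⟩
    exact ⟨M * P, by rw [det_mul]; exact hM.mul hP, by rw [Matrix.mul_assoc]⟩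
  · rintro ⟨M, hM, rfl⟩
    refine ⟨M * P⁻¹, ?_, ?_⟩
    · rw [det_mul]
      exact hM.mul (isUnit_nonsing_inv_det P hP)
    · rw [Matrix.mul_assoc, nonsing_inv_mul_cancel_left P B hP]

theorem rightCoset_eq_iff {B C : Matrix (Fin 2) (Fin 2) O} :
    rightCoset B = rightCoset C ↔ ∃ P, IsUnit P.det ∧ C = P * B := by
  constructor
  · intro h
    have : C ∈ rightCoset B := h ▸ mem_rightCoset.2 ⟨1, by simp, one_mul C⟩
    obtain ⟨P, hP, e⟩ := mem_rightCoset.1 this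
    exact ⟨P, hP, e.symm⟩
  · rintro ⟨P, hP, rfl⟩
    exact (rightCoset_mul_left hP B).symm

theorem rightCosetsIn_eq_image (A : Matrix (Fin 2) (Fin 2) O) :
    rightCosetsIn A = (fun Q => rightCoset (A * Q)) '' unimodular O := by
  ext X
  simp only [rightCosetsIn, Set.mem_image, DoubleCoset.mem_doubleCoset]
  constructor
  · rintro ⟨_, ⟨P, hP, Q, hQ, rfl⟩, rfl⟩
    exact ⟨Q, hQ, by rw [Matrix.mul_assoc, rightCoset_mul_left hP]⟩
  · rintro ⟨Q, hQ, rfl⟩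
    exact ⟨_, ⟨1, by simp [unimodular], Q, hQ, by rw [one_mul]⟩, rfl⟩

/-- The column vectors which `B` maps to vectors with entries in `J`. -/
def columnsInto (J : Ideal O) (B : Matrix (Fin 2) (Fin 2) O) : Submodule O (Fin 2 → O) :=
  (Submodule.pi Set.univ fun _ => J).comap B.mulVecLin

theorem mem_columnsInto {J : Ideal O} {B : Matrix (Fin 2) (Fin 2) O} {v : Fin 2 → O} :
    v ∈ columnsInto J B ↔ ∀ i, (B *ᵥ v) i ∈ J := by
  simp [columnsInto, Submodule.mem_pi]

theorem mem_columnsInto_mul {J : Ideal O} {A Q : Matrix (Fin 2) (Fin 2) O} {v : Fin 2 → O} :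
    v ∈ columnsInto J (A * Q) ↔ Q *ᵥ v ∈ columnsInto J A := by
  rw [mem_columnsInto, mem_columnsInto, mulVec_mulVec]

theorem columnsInto_le_mul_left (J : Ideal O) (P B : Matrix (Fin 2) (Fin 2) O) :
    columnsInto J B ≤ columnsInto J (P * B) := fun v hv => by
  rw [mem_columnsInto] at hv ⊢
  intro i
  rw [← mulVec_mulVec]
  change ∑ j, P i j * (B *ᵥ v) j ∈ J
  exact J.sum_mem fun j _ => J.mul_mem_left _ (hv j)

theorem columnsInto_mul_left (J : Ideal O) {P : Matrix (Fin 2) (Fin 2) O} (hP : IsUnit P.det)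
    (B : Matrix (Fin 2) (Fin 2) O) : columnsInto J (P * B) = columnsInto J B := by
  refine le_antisymm ?_ (columnsInto_le_mul_left J P B)
  simpa only [nonsing_inv_mul_cancel_left P B hP] using columnsInto_le_mul_left J P⁻¹ (P * B)

theorem entry_mem_detDivisor₁ (A : Matrix (Fin 2) (Fin 2) O) (i j : Fin 2) :
    A i j ∈ detDivisor₁ A := by
  apply Ideal.subset_span
  fin_cases i <;> fin_cases j <;> simp

theorem adjugate_mem_detDivisor₁ (A : Matrix (Fin 2) (Fin 2) O) (i j : Fin 2) :
    A.adjugate i j ∈ detDivisor₁ A := by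
  rw [adjugate_fin_two]
  fin_cases i <;> fin_cases j
  · exact entry_mem_detDivisor₁ A 1 1
  · exact neg_mem (entry_mem_detDivisor₁ A 0 1)
  · exact neg_mem (entry_mem_detDivisor₁ A 1 0)
  · exact entry_mem_detDivisor₁ A 0 0

theorem detDivisor₁_le_of_adjugate_mem {A : Matrix (Fin 2) (Fin 2) O} {I : Ideal O}
    (h : ∀ i j, A.adjugate i j ∈ I) : detDivisor₁ A ≤ I := by
  rw [adjugate_fin_two] at h
  refine Ideal.span_le.2 ?_
  rintro _ (rfl | rfl | rfl | rfl)
  · exact h 1 1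
  · exact neg_mem_iff.1 (h 0 1)
  · exact neg_mem_iff.1 (h 1 0)
  · exact h 0 0

theorem mem_columnsInto_of_forall_mem {A : Matrix (Fin 2) (Fin 2) O} {𝔣 : Ideal O}
    {v : Fin 2 → O} (hv : ∀ i, v i ∈ 𝔣) :
    v ∈ columnsInto (𝔣 * detDivisor₁ A) A :=
  mem_columnsInto.2 fun i => by
    change ∑ j, A i j * v j ∈ _
    rw [mul_comm 𝔣]
    exact Ideal.sum_mem _ fun j _ => Ideal.mul_mem_mul (entry_mem_detDivisor₁ A i j) (hv j)

theorem det_mem_detDivisor₁_sq (A : Matrix (Fin 2) (Fin 2) O) : A.det ∈ detDivisor₁ A ^ 2 := by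
  rw [det_fin_two, pow_two]
  exact sub_mem (Ideal.mul_mem_mul (entry_mem_detDivisor₁ A 0 0) (entry_mem_detDivisor₁ A 1 1))
    (Ideal.mul_mem_mul (entry_mem_detDivisor₁ A 0 1) (entry_mem_detDivisor₁ A 1 0))

theorem detDivisor₁_ne_bot {A : Matrix (Fin 2) (Fin 2) O} (hA : A.det ≠ 0) :
    detDivisor₁ A ≠ ⊥ := fun h => hA <| by
  simpa [h] using det_mem_detDivisor₁_sq A

end Cosets

/-! ### The module `columnsInto` as a line modulo `𝔣` and as a complete invariant of the coset. -/

section Invariant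

variable {O : Type*} [CommRing O] [IsDedekindDomain O] {A : Matrix (Fin 2) (Fin 2) O}
  {𝔣 : Ideal O}

theorem exists_detDivisor₂_eq (A : Matrix (Fin 2) (Fin 2) O) :
    ∃ 𝔣 : Ideal O, detDivisor₂ A = 𝔣 * detDivisor₁ A ^ 2 := by
  obtain ⟨𝔣, h⟩ : detDivisor₁ A ^ 2 ∣ detDivisor₂ A :=
    Ideal.dvd_iff_le.2 ((Ideal.span_singleton_le_iff_mem _).2 (det_mem_detDivisor₁_sq A))
  exact ⟨𝔣, h.trans (mul_comm _ _)⟩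

/-- `J` plays the role of `δ I⁻¹`, so that inverses of ideals can be handled inside `O`. -/
theorem exists_mul_eq_span_singleton {I : Ideal O} (hI : I ≠ ⊥) :
    ∃ (J : Ideal O) (δ : O), δ ≠ 0 ∧ I * J = Ideal.span {δ} := by
  obtain ⟨δ, hδ, hδ0⟩ := Submodule.exists_mem_ne_zero_of_ne_bot hI
  obtain ⟨J, hJ⟩ := Ideal.dvd_iff_le.2 ((Ideal.span_singleton_le_iff_mem I).2 hδ)
  exact ⟨J, δ, hδ0, hJ.symm⟩

/-- Up to the factor `δ`, the columns of the adjugate scaled by the inverse of `detDivisor₁ A`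
lie in `columnsInto (𝔣 * detDivisor₁ A) A`. -/
theorem exists_mem_columnsInto (h𝔣 : detDivisor₂ A = 𝔣 * detDivisor₁ A ^ 2) {J : Ideal O} {δ : O}
    (hδ : δ ≠ 0) (hJ : detDivisor₁ A * J = Ideal.span {δ}) {x : O} (hx : x ∈ J) (j : Fin 2) :
    ∃ v ∈ columnsInto (𝔣 * detDivisor₁ A) A, ∀ i, δ * v i = x * A.adjugate i j := by
  have h : ∀ i, ∃ z, δ * z = x * A.adjugate i j := fun i => by
    have : x * A.adjugate i j ∈ Ideal.span {δ} := by
      rw [← hJ, mul_comm (detDivisor₁ A)]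
      exact Ideal.mul_mem_mul hx (adjugate_mem_detDivisor₁ A i j)
    obtain ⟨z, hz⟩ := Ideal.mem_span_singleton.1 this
    exact ⟨z, hz.symm⟩
  choose v hv using h
  refine ⟨v, mem_columnsInto.2 fun i => ?_, hv⟩
  have h1 : δ * (A *ᵥ v) i = x * (A * A.adjugate) i j := by
    simp only [mulVec, dotProduct, Matrix.mul_apply, Finset.mul_sum]
    refine Finset.sum_congr rfl fun l _ => ?_
    linear_combination A i l * hv l
  have h2 : δ * (A *ᵥ v) i ∈ Ideal.span {δ} * (𝔣 * detDivisor₁ A) := by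
    have e : Ideal.span {δ} * (𝔣 * detDivisor₁ A) = J * detDivisor₂ A := by
      rw [← hJ, h𝔣]
      ring
    rw [e, h1, mul_adjugate, Matrix.smul_apply, smul_eq_mul]
    exact Ideal.mul_mem_mul hx (Ideal.mul_mem_right _ _ (Ideal.mem_span_singleton_self _))
  obtain ⟨z, hz, e⟩ := Ideal.mem_span_singleton_mul.1 h2
  rwa [← mul_left_cancel₀ hδ e]

/-- The entries of the adjugate generate `detDivisor₁ A`, so after scaling by its inverse they
generate the unit ideal and cannot all lie in `p`. -/
theorem exists_mem_columnsInto_notMem (hA : A.det ≠ 0)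
    (h𝔣 : detDivisor₂ A = 𝔣 * detDivisor₁ A ^ 2) {p : Ideal O} (hp : p ≠ ⊤) :
    ∃ v ∈ columnsInto (𝔣 * detDivisor₁ A) A, ∃ i, v i ∉ p := by
  obtain ⟨J, δ, hδ, hJ⟩ := exists_mul_eq_span_singleton (detDivisor₁_ne_bot hA)
  by_contra! hcon
  have hle : detDivisor₁ A * J ≤ Ideal.span {δ} * p := by
    rw [mul_comm, Ideal.mul_le]
    intro x hx y hy
    have : detDivisor₁ A ≤ Submodule.comap (LinearMap.mulLeft O x) (Ideal.span {δ} * p) :=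
      detDivisor₁_le_of_adjugate_mem fun i j => by
        obtain ⟨v, hv, hvx⟩ := exists_mem_columnsInto h𝔣 hδ hJ hx j
        change x * A.adjugate i j ∈ Ideal.span {δ} * p
        rw [← hvx i]
        exact Ideal.mul_mem_mul (Ideal.mem_span_singleton_self δ) (hcon v hv i)
    exact this hy
  rw [hJ, Ideal.span_singleton_le_iff_mem] at hle
  obtain ⟨z, hz, e⟩ := Ideal.mem_span_singleton_mul.1 hle
  have : z = 1 := mul_left_cancel₀ hδ (by rw [e, mul_one])
  exact hp ((Ideal.eq_top_iff_one p).2 (this ▸ hz))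

/-- The determinant with columns `A *ᵥ v`, `A *ᵥ w` is `A.det` times that of `v`, `w`, and it lies
in `(𝔣 * detDivisor₁ A) ^ 2 = A.det · 𝔣`. -/
theorem cross_mem_of_mem_columnsInto (hA : A.det ≠ 0)
    (h𝔣 : detDivisor₂ A = 𝔣 * detDivisor₁ A ^ 2) {v w : Fin 2 → O}
    (hv : v ∈ columnsInto (𝔣 * detDivisor₁ A) A) (hw : w ∈ columnsInto (𝔣 * detDivisor₁ A) A) :
    v 0 * w 1 - v 1 * w 0 ∈ 𝔣 := by
  rw [mem_columnsInto] at hv hw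
  have h1 : A.det * (v 0 * w 1 - v 1 * w 0) =
      (A *ᵥ v) 0 * (A *ᵥ w) 1 - (A *ᵥ v) 1 * (A *ᵥ w) 0 := by
    simp only [det_fin_two, mulVec, dotProduct, Fin.sum_univ_two]
    ring
  have h2 : A.det * (v 0 * w 1 - v 1 * w 0) ∈ Ideal.span {A.det} * 𝔣 := by
    have e : Ideal.span {A.det} * 𝔣 = 𝔣 * detDivisor₁ A * (𝔣 * detDivisor₁ A) := by
      rw [← detDivisor₂, h𝔣]
      ring
    rw [e, h1]
    exact sub_mem (Ideal.mul_mem_mul (hv 0) (hw 1)) (Ideal.mul_mem_mul (hv 1) (hw 0))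
  obtain ⟨z, hz, e⟩ := Ideal.mem_span_singleton_mul.1 h2
  rwa [← mul_left_cancel₀ hA e]

/-- For each prime `p` dividing `𝔣` there is a vector of the module that is nonzero modulo `p`;
Chinese remainder coefficients glue these into one. -/
theorem exists_mem_columnsInto_isCoprime (hA : A.det ≠ 0)
    (h𝔣 : detDivisor₂ A = 𝔣 * detDivisor₁ A ^ 2) (h0 : 𝔣 ≠ ⊥) :
    ∃ g ∈ columnsInto (𝔣 * detDivisor₁ A) A,
      IsCoprime (Ideal.Quotient.mk 𝔣 (g 0)) (Ideal.Quotient.mk 𝔣 (g 1)) := by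
  classical
  let _ : Fintype (primeDivisors 𝔣) := (primeDivisors_finite h0).fintype
  have hex : ∀ p : primeDivisors 𝔣, ∃ v ∈ columnsInto (𝔣 * detDivisor₁ A) A, ∃ i, v i ∉ p.1 :=
    fun p => exists_mem_columnsInto_notMem hA h𝔣 p.2.1.ne_top
  choose v hv i hi using hex
  have hcrt : ∀ p : primeDivisors 𝔣, ∃ r : O, ∀ q : primeDivisors 𝔣,
      r - (if q = p then 1 else 0) ∈ q.1 := fun p =>
    Ideal.exists_forall_sub_mem_ideal (pairwise_isCoprime_primeDivisors h0) _
  choose r hr using hcrt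
  refine ⟨∑ p, r p • v p, Submodule.sum_mem _ fun p _ => Submodule.smul_mem _ _ (hv p), ?_⟩
  have hcong : ∀ q : primeDivisors 𝔣, ∀ j, (∑ p, r p • v p) j - v q j ∈ q.1 := fun q j => by
    have e : (∑ p, r p • v p) j - v q j = ∑ p, (r p - if q = p then 1 else 0) * v p j := by
      simp [sub_mul, Finset.sum_sub_distrib, Finset.sum_apply]
    rw [e]
    exact Ideal.sum_mem _ fun p _ => Ideal.mul_mem_right _ _ (hr p q)
  rw [isCoprime_mk_iff h0]
  intro p hp hmem
  refine hi ⟨p, hp⟩ ?_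
  have hall : ∀ j, (∑ p, r p • v p) j ∈ p := Fin.forall_fin_two.2 hmem
  exact (Submodule.sub_mem_iff_right p (hall _)).1 (hcong ⟨p, hp⟩ _)

/-- Modulo `𝔣`, the module `columnsInto (𝔣 * detDivisor₁ A) A` is a line. -/
theorem exists_columnsInto_eq_line (hA : A.det ≠ 0)
    (h𝔣 : detDivisor₂ A = 𝔣 * detDivisor₁ A ^ 2) (h0 : 𝔣 ≠ ⊥) :
    ∃ g : Fin 2 → O ⧸ 𝔣, IsCoprime (g 0) (g 1) ∧ ∀ v : Fin 2 → O,
      v ∈ columnsInto (𝔣 * detDivisor₁ A) A ↔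
        Ideal.Quotient.mk 𝔣 ∘ v ∈ Submodule.span (O ⧸ 𝔣) {g} := by
  obtain ⟨g, hg, hcop⟩ := exists_mem_columnsInto_isCoprime hA h𝔣 h0
  refine ⟨Ideal.Quotient.mk 𝔣 ∘ g, hcop, fun v => ?_⟩
  rw [Submodule.mem_span_singleton]
  constructor
  · intro hv
    obtain ⟨a, b, hab⟩ := hcop
    have hx := Ideal.Quotient.eq_zero_iff_mem.2 (cross_mem_of_mem_columnsInto hA h𝔣 hg hv)
    simp only [map_sub, map_mul] at hx
    -- The Bézout functional of `g` applied to `v`; as the cross product vanishes modulo `𝔣`, it is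
    -- the ratio of `v` to `g`.
    refine ⟨a * Ideal.Quotient.mk 𝔣 (v 0) + b * Ideal.Quotient.mk 𝔣 (v 1), funext
      (Fin.forall_fin_two.2 ⟨?_, ?_⟩)⟩
    · simp only [Pi.smul_apply, Function.comp_apply, smul_eq_mul]
      linear_combination b * hx + Ideal.Quotient.mk 𝔣 (v 0) * hab
    · simp only [Pi.smul_apply, Function.comp_apply, smul_eq_mul]
      linear_combination -a * hx + Ideal.Quotient.mk 𝔣 (v 1) * hab
  · rintro ⟨c, hc⟩
    obtain ⟨c, rfl⟩ := Ideal.Quotient.mk_surjective c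
    have hd : v - c • g ∈ columnsInto (𝔣 * detDivisor₁ A) A :=
      mem_columnsInto_of_forall_mem fun i => by
        rw [← Ideal.Quotient.eq_zero_iff_mem, Pi.sub_apply, map_sub, sub_eq_zero]
        exact (congrFun hc i).symm.trans (map_mul _ _ _).symm
    simpa using add_mem hd (Submodule.smul_mem _ c hg)

/-- The module `columnsInto (𝔣 * detDivisor₁ A) A` determines the right coset. -/
theorem exists_mul_eq_of_columnsInto_le (hA : A.det ≠ 0)
    (h𝔣 : detDivisor₂ A = 𝔣 * detDivisor₁ A ^ 2) {T : Matrix (Fin 2) (Fin 2) O}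
    (hT : IsUnit T.det)
    (hle : columnsInto (𝔣 * detDivisor₁ A) A ≤ columnsInto (𝔣 * detDivisor₁ A) (A * T)) :
    ∃ M, IsUnit M.det ∧ A * T = M * A := by
  obtain ⟨J, δ, hδ, hJ⟩ := exists_mul_eq_span_singleton (detDivisor₁_ne_bot hA)
  have hJ0 : J ≠ 0 := by
    rintro rfl
    exact hδ (by simpa using hJ.symm)
  have hdvd : ∀ i j, ∃ m, (A * T * A.adjugate) i j = A.det * m := fun i j => by
    -- The matrix sought is `A T A⁻¹`, which is integral if `A.det` divides these entries. The
    -- divisibility is checked after multiplying by `J`, where `hle` applies to the scaled adjugate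
    -- columns.
    have hmul : J * Ideal.span {(A * T * A.adjugate) i j} ≤ J * Ideal.span {A.det} := by
      rw [Ideal.mul_le]
      intro x hx y hy
      obtain ⟨c, rfl⟩ := Ideal.mem_span_singleton.1 hy
      rw [← mul_assoc]
      refine Ideal.mul_mem_right _ _ ?_
      obtain ⟨v, hv, hvx⟩ := exists_mem_columnsInto h𝔣 hδ hJ hx j
      have e1 : x * (A * T * A.adjugate) i j = δ * ((A * T) *ᵥ v) i := by
        rw [Matrix.mul_apply]
        simp only [mulVec, dotProduct, Finset.mul_sum]
        refine Finset.sum_congr rfl fun l _ => ?_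
        linear_combination -(A * T) i l * hvx l
      have e2 : J * Ideal.span {A.det} = Ideal.span {δ} * (𝔣 * detDivisor₁ A) := by
        rw [← hJ, ← detDivisor₂, h𝔣]
        ring
      rw [e1, e2]
      exact Ideal.mul_mem_mul (Ideal.mem_span_singleton_self δ) (mem_columnsInto.1 (hle hv) i)
    have := (mul_dvd_mul_iff_left hJ0).1 (Ideal.dvd_iff_le.2 hmul)
    rw [Ideal.dvd_iff_le, Ideal.span_singleton_le_iff_mem] at this
    exact Ideal.mem_span_singleton.1 this
  choose m hm using hdvd
  have hM : A * T * A.adjugate = A.det • Matrix.of m := by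
    ext i j
    simpa using hm i j
  have hMA : A * T = Matrix.of m * A := by
    have e : A.det • (A * T) = A.det • (Matrix.of m * A) := by
      rw [← Matrix.smul_mul (A.det) (Matrix.of m), ← hM, Matrix.mul_assoc, adjugate_mul, Matrix.mul_smul, Matrix.mul_one]
    ext i j
    exact mul_left_cancel₀ hA (congrFun (congrFun e i) j)
  refine ⟨Matrix.of m, ?_, hMA⟩
  have hdet := congrArg det hMA
  rw [det_mul, det_mul, mul_comm] at hdet
  rwa [← mul_right_cancel₀ hA hdet]

end Invariant

/-! ### The action of `U` on lines and the bijection with cosets. -/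

section Main

/-- Two images of the same set under maps with the same fibres are equinumerous. -/
theorem finite_and_ncard_image_eq {α β γ : Type*} [Nonempty γ] {s : Set α} {f : α → β} {g : α → γ}
    (h : ∀ a ∈ s, ∀ b ∈ s, f a = f b ↔ g a = g b) (hg : (g '' s).Finite) :
    (f '' s).Finite ∧ (f '' s).ncard = (g '' s).ncard := by
  classical
  obtain ⟨c⟩ := ‹Nonempty γ›
  let k : β → γ := fun y => if hy : ∃ a ∈ s, f a = y then g hy.choose else c
  have hk : ∀ a ∈ s, k (f a) = g a := fun a ha => by
    have hy : ∃ b ∈ s, f b = f a := ⟨a, ha, rfl⟩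
    change (if hy : ∃ b ∈ s, f b = f a then g hy.choose else c) = g a
    rw [dif_pos hy]
    exact (h _ hy.choose_spec.1 _ ha).1 hy.choose_spec.2
  have himg : k '' (f '' s) = g '' s := by
    rw [Set.image_image]
    exact Set.image_congr hk
  have hinj : Set.InjOn k (f '' s) := by
    rintro _ ⟨a, ha, rfl⟩ _ ⟨b, hb, rfl⟩ hab
    rw [hk a ha, hk b hb] at hab
    exact (h a ha b hb).2 hab
  rw [← himg] at hg ⊢
  exact ⟨Set.Finite.of_finite_image hg hinj, hinj.ncard_image.symm⟩

theorem isCoprime_mulVec {R : Type*} [CommRing R] {Q : Matrix (Fin 2) (Fin 2) R}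
    (hQ : IsUnit Q.det) {w : Fin 2 → R} (hw : IsCoprime (w 0) (w 1)) :
    IsCoprime ((Q *ᵥ w) 0) ((Q *ᵥ w) 1) := by
  have key : ∀ v : Fin 2 → R, IsCoprime (v 0) (v 1) ↔ ∃ a : Fin 2 → R, a ⬝ᵥ v = 1 := fun v => by
    simp only [dotProduct, Fin.sum_univ_two]
    exact ⟨fun ⟨a, b, h⟩ => ⟨![a, b], h⟩, fun ⟨a, h⟩ => ⟨a 0, a 1, h⟩⟩
  obtain ⟨a, ha⟩ := (key w).1 hw
  refine (key _).2 ⟨a ᵥ* Q⁻¹, ?_⟩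
  rw [← dotProduct_mulVec, mulVec_mulVec, nonsing_inv_mul Q hQ, one_mulVec, ha]

variable {O : Type*} [CommRing O] [IsDedekindDomain O]

/-- A unimodular lift of `w` is completed to a matrix by its Bézout coefficients. -/
theorem exists_det_eq_one_mulVec_eq {I : Ideal O} (hI : I ≠ ⊥) (w : Fin 2 → O ⧸ I)
    (hw : IsCoprime (w 0) (w 1)) :
    ∃ M : Matrix (Fin 2) (Fin 2) O, M.det = 1 ∧ M.map (Ideal.Quotient.mk I) *ᵥ ![1, 0] = w := by
  obtain ⟨x, y, ⟨a, b, hab⟩, hx, hy⟩ := exists_isCoprime_lift hI _ _ hw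
  refine ⟨!![x, -b; y, a], ?_, funext (Fin.forall_fin_two.2 ⟨?_, ?_⟩)⟩
  · rw [det_fin_two_of]
    linear_combination hab
  · simp [mulVec, dotProduct, hx]
  · simp [mulVec, dotProduct, hy]

theorem exists_isUnit_det_mulVec_eq {I : Ideal O} (hI : I ≠ ⊥) {g w : Fin 2 → O ⧸ I}
    (hg : IsCoprime (g 0) (g 1)) (hw : IsCoprime (w 0) (w 1)) :
    ∃ Q : Matrix (Fin 2) (Fin 2) O, IsUnit Q.det ∧ Q.map (Ideal.Quotient.mk I) *ᵥ w = g := by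
  obtain ⟨M, hM, rfl⟩ := exists_det_eq_one_mulVec_eq hI g hg
  obtain ⟨N, hN, rfl⟩ := exists_det_eq_one_mulVec_eq hI w hw
  refine ⟨M * N.adjugate, by simp [det_mul, hM, hN, det_adjugate], ?_⟩
  rw [mulVec_mulVec, ← Matrix.map_mul, Matrix.mul_assoc, adjugate_mul, hN, one_smul,
    Matrix.mul_one]

theorem comap_mulVecLin_span {R : Type*} [CommRing R] {Q : Matrix (Fin 2) (Fin 2) R}
    (hQ : IsUnit Q.det) (w : Fin 2 → R) :
    (Submodule.span R {Q *ᵥ w}).comap Q.mulVecLin = Submodule.span R {w} := by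
  ext v
  simp only [Submodule.mem_comap, Submodule.mem_span_singleton, mulVecLin_apply, ← mulVec_smul]
  exact exists_congr fun c => (mulVec_injective_of_isUnit ((isUnit_iff_isUnit_det Q).2 hQ)).eq_iff

theorem isUnit_det_map {R S : Type*} [CommRing R] [CommRing S] (φ : R →+* S)
    {Q : Matrix (Fin 2) (Fin 2) R} (hQ : IsUnit Q.det) : IsUnit (Q.map φ).det := by
  rw [← RingHom.mapMatrix_apply, ← RingHom.map_det]
  exact hQ.map φ

theorem image_comap_mulVecLin_eq_lines {I : Ideal O} (hI : I ≠ ⊥) {g : Fin 2 → O ⧸ I}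
    (hg : IsCoprime (g 0) (g 1)) :
    (fun Q : Matrix (Fin 2) (Fin 2) O => (Submodule.span (O ⧸ I) {g}).comap
      (Q.map (Ideal.Quotient.mk I)).mulVecLin) '' unimodular O = lines (O ⧸ I) := by
  ext L
  constructor
  · rintro ⟨Q, hQ, rfl⟩
    have hQ' := isUnit_det_map (Ideal.Quotient.mk I) hQ
    refine ⟨(Q.map (Ideal.Quotient.mk I))⁻¹ *ᵥ g,
      isCoprime_mulVec (isUnit_nonsing_inv_det _ hQ') hg, ?_⟩
    have e : g = Q.map (Ideal.Quotient.mk I) *ᵥ ((Q.map (Ideal.Quotient.mk I))⁻¹ *ᵥ g) := by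
      rw [mulVec_mulVec, mul_nonsing_inv _ hQ', one_mulVec]
    dsimp only
    conv_rhs => rw [e]
    rw [comap_mulVecLin_span hQ']
  · rintro ⟨w, hw, rfl⟩
    obtain ⟨Q, hQ, rfl⟩ := exists_isUnit_det_mulVec_eq hI hg hw
    exact ⟨Q, hQ, comap_mulVecLin_span (isUnit_det_map _ hQ) w⟩

theorem rightCoset_mul_eq_iff {A : Matrix (Fin 2) (Fin 2) O} (hA : A.det ≠ 0) {𝔣 : Ideal O}
    (h𝔣 : detDivisor₂ A = 𝔣 * detDivisor₁ A ^ 2) {Q T : Matrix (Fin 2) (Fin 2) O}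
    (hQ : IsUnit Q.det) (hT : IsUnit T.det) :
    rightCoset (A * Q) = rightCoset (A * T) ↔
      columnsInto (𝔣 * detDivisor₁ A) (A * Q) = columnsInto (𝔣 * detDivisor₁ A) (A * T) := by
  rw [rightCoset_eq_iff]
  constructor
  · rintro ⟨P, hP, e⟩
    rw [e, columnsInto_mul_left _ hP]
  · intro h
    -- Translation by `Q⁻¹` reduces the comparison of `A * Q` and `A * T` to that of `A` and `A * (T
    -- * Q⁻¹)`.
    obtain ⟨M, hM, e⟩ := exists_mul_eq_of_columnsInto_le hA h𝔣 (T := T * Q⁻¹)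
      (by rw [det_mul]; exact hT.mul (isUnit_nonsing_inv_det Q hQ)) fun v hv => by
        rw [← Matrix.mul_assoc, mem_columnsInto_mul, ← h, mem_columnsInto_mul, mulVec_mulVec,
          mul_nonsing_inv Q hQ, one_mulVec]
        exact hv
    refine ⟨M, hM, ?_⟩
    rw [← Matrix.mul_assoc M, ← e, ← Matrix.mul_assoc, nonsing_inv_mul_cancel_right _ _ hQ]

theorem finite_rightCosetsIn_and_ncard_eq {A : Matrix (Fin 2) (Fin 2) O} (hA : A.det ≠ 0)
    {𝔣 : Ideal O} (h𝔣 : detDivisor₂ A = 𝔣 * detDivisor₁ A ^ 2) (h0 : 𝔣 ≠ ⊥) [Finite (O ⧸ 𝔣)] :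
    (rightCosetsIn A).Finite ∧ (rightCosetsIn A).ncard = (lines (O ⧸ 𝔣)).ncard := by
  obtain ⟨g, hg, hmem⟩ := exists_columnsInto_eq_line hA h𝔣 h0
  rw [rightCosetsIn_eq_image, ← image_comap_mulVecLin_eq_lines h0 hg]
  have hcol : ∀ (Q : Matrix (Fin 2) (Fin 2) O) (v : Fin 2 → O),
      v ∈ columnsInto (𝔣 * detDivisor₁ A) (A * Q) ↔ Ideal.Quotient.mk 𝔣 ∘ v ∈
        (Submodule.span (O ⧸ 𝔣) {g}).comap (Q.map (Ideal.Quotient.mk 𝔣)).mulVecLin := by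
    intro Q v
    rw [mem_columnsInto_mul, hmem, Submodule.mem_comap, mulVecLin_apply]
    have e : Ideal.Quotient.mk 𝔣 ∘ (Q *ᵥ v) =
        Q.map (Ideal.Quotient.mk 𝔣) *ᵥ (Ideal.Quotient.mk 𝔣 ∘ v) :=
      funext fun i => RingHom.map_mulVec _ _ _ _
    rw [e]
  -- Cosets and lines are both images of `U`, so it is enough that the two maps have the same
  -- fibres.
  refine finite_and_ncard_image_eq (fun Q hQ T hT => ?_) (Set.toFinite _)
  rw [rightCoset_mul_eq_iff hA h𝔣 hQ hT, SetLike.ext_iff, SetLike.ext_iff]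
  simp only [hcol]
  have hsurj : Function.Surjective fun v : Fin 2 → O => Ideal.Quotient.mk 𝔣 ∘ v :=
    (Ideal.Quotient.mk_surjective (I := 𝔣)).comp_left
  refine ⟨fun h w => ?_, fun h v => h _⟩
  obtain ⟨v, rfl⟩ := hsurj w
  exact h v

end Main

end CosetCount

theorem theorem3 {O : Type*} [CommRing O] [IsDedekindDomain O]
    (hO : ∀ a : O, a ≠ 0 → Finite (O ⧸ Ideal.span {a}))
    (K : Type*) [Field K] [Algebra O K] [IsFractionRing O K]
    (A : Matrix (Fin 2) (Fin 2) O) (hA : A.det ≠ 0) :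
    (CosetCount.rightCosetsIn A).Finite ∧
    ∃ 𝔣 : Ideal O, 𝔣 ≠ ⊥ ∧
      (𝔣 : FractionalIdeal O⁰ K) = CosetCount.fundamentalFactor₂ K A ∧
      ((CosetCount.rightCosetsIn A).ncard : ℚ) =
        (CosetCount.idealNorm 𝔣 : ℚ) *
          ∏ᶠ p ∈ CosetCount.primeDivisors 𝔣, (1 + (CosetCount.idealNorm p : ℚ)⁻¹) := by
  obtain ⟨𝔣, h𝔣⟩ := CosetCount.exists_detDivisor₂_eq A
  have hdet : A.det ∈ 𝔣 := by
    have : A.det ∈ CosetCount.detDivisor₂ A := Ideal.mem_span_singleton_self _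
    rw [h𝔣] at this
    exact (Ideal.mul_le_left : 𝔣 * CosetCount.detDivisor₁ A ^ 2 ≤ 𝔣) this
  have h0 : 𝔣 ≠ ⊥ := fun h => hA (Ideal.mem_bot.1 (h ▸ hdet))
  have hfin : Finite (O ⧸ 𝔣) :=
    have := hO A.det hA
    Finite.of_surjective _ (Ideal.Quotient.factor_surjective
      ((Ideal.span_singleton_le_iff_mem 𝔣).2 hdet))
  obtain ⟨h1, h2⟩ := CosetCount.finite_rightCosetsIn_and_ncard_eq hA h𝔣 h0
  refine ⟨h1, 𝔣, h0, ?_, by rw [h2, CosetCount.ncard_lines_quotient h0]⟩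
  have hd : (CosetCount.detDivisor₁ A : FractionalIdeal O⁰ K) ≠ 0 :=
    FractionalIdeal.coeIdeal_ne_zero.2 (CosetCount.detDivisor₁_ne_bot hA)
  rw [CosetCount.fundamentalFactor₂, h𝔣, FractionalIdeal.coeIdeal_mul,
    FractionalIdeal.coeIdeal_pow, mul_assoc, zpow_neg, zpow_ofNat,
    mul_inv_cancel₀ (pow_ne_zero 2 hd), mul_one]
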